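/- Let $V$ be a set of $n\ge 2$ nodes and $T$ a set of $k$ tokens, $1\le k\le n$. A dynamic network of size $n$ is a sequence $G_1,G_2,\dots$ of connected graphs on $V$, fixed in advance; initially every token is known to at least one node (otherwise arbitrarily). With $1$-smoothing, in each round $r$ one edge is drawn uniformly at random from all $\binom n2$ pairs of distinct nodes and added to $G_r$ if not already present, giving $\hat G_r$. In random broadcast, in each round every node that knows at least one token broadcasts one of the tokens it knows at the beginning of the round, chosen uniformly at random, and this token is learned by all its neighbours in $\hat G_r$. All random choices, over nodes and rounds and for the smoothing edges, are independent. The $k$-message broadcast problem is solved once every node knows all $k$ tokens. Then, with $1$-smoothing, random broadcast solves $k$-message broadcast in any dynamic network of size $n$ with $k\le n$ in $O(n+k^3\log n)$ rounds with high probability. That is: for every real $x\ge 1$ there is a constant $C>0$, depending only on $x$, such that for all $n,k$, every dynamic network, every initial token distribution as above, and every integer $R\ge C\,(n+k^3\log n)$, the probability that some node does not know all $k$ tokens after $R$ rounds is at most $n^{-x}$. -/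

import Mathlib

open scoped ENNReal

noncomputable section

namespace KBroadcast

variable {V T : Type*}

/-- A knowledge state of the network: `K v` is the set of tokens known by the node `v`. -/
abbrev Knowledge (V T : Type*) := V → Finset T

/-- `k`-message broadcast is solved: every node knows every token. -/
def Solved (K : Knowledge V T) : Prop := ∀ v t, t ∈ K v

/-- The set of all possible edges on the node set `V`, that is, of all unordered pairs of
distinct nodes. -/
abbrev PossibleEdge (V : Type*) := (⊤ : SimpleGraph V).edgeSet

instance [Nontrivial V] : Nonempty (PossibleEdge V) := by
  obtain ⟨u, v, h⟩ := exists_pair_ne V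
  exact ⟨⟨s(u, v), by simpa using h⟩⟩

/-- The graph `G` with the edges `e 0, …, e (ℓ - 1)` added (those already present are ignored). -/
def addEdges {ℓ : ℕ} (G : SimpleGraph V) (e : Fin ℓ → PossibleEdge V) : SimpleGraph V :=
  G ⊔ SimpleGraph.fromEdgeSet (Set.range fun i => (e i : Sym2 V))

/-- `ℓ`-smoothing of `G`: add `ℓ` edges drawn independently and uniformly (with replacement)
from all possible edges. The uniform law on `Fin ℓ → PossibleEdge V` is the law of `ℓ`
independent uniform edges. -/
def smoothing [Fintype V] [DecidableEq V] [Nontrivial V] (ℓ : ℕ) (G : SimpleGraph V) :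
    PMF (SimpleGraph V) :=
  (PMF.uniformOfFintype (Fin ℓ → PossibleEdge V)).map (addEdges G)

/-- The possible messages of a node that knows exactly the tokens in `S`: one token of `S`,
or nothing (`none`) if `S` is empty. -/
def messages [DecidableEq T] (S : Finset T) : Finset (Option T) :=
  if S.Nonempty then S.image some else {none}

theorem messages_nonempty [DecidableEq T] (S : Finset T) : (messages S).Nonempty := by
  unfold messages
  split_ifs with h
  · exact h.image _
  · exact Finset.singleton_nonempty _

/-- The broadcasts of all nodes in one round of random broadcast: independently of each other,
every node draws a token uniformly at random from those that it knows. (The uniform law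
on a finite product of finite sets is the product of the uniform laws on the factors.) -/
def randomBroadcast [Fintype V] [DecidableEq V] [DecidableEq T] (K : Knowledge V T) :
    PMF (V → Option T) :=
  PMF.uniformOfFinset (Fintype.piFinset fun v => messages (K v))
    (Fintype.piFinset_nonempty.2 fun v => messages_nonempty (K v))

open Classical in
/-- The knowledge at the end of a round with topology `H`, knowledge `K` at its beginning and
broadcasts `m`: every node also learns the tokens broadcast by its neighbours in `H`. -/
def deliver [Fintype T] (H : SimpleGraph V) (K : Knowledge V T) (m : V → Option T) :
    Knowledge V T :=
  fun v => Finset.univ.filter fun t => t ∈ K v ∨ ∃ u, H.Adj u v ∧ m u = some t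

/-- One round of random broadcast in the graph `G` with `ℓ`-smoothing; the smoothing edges and the
broadcasts are drawn independently. -/
def round [Fintype V] [DecidableEq V] [Nontrivial V] [Fintype T] [DecidableEq T]
    (ℓ : ℕ) (G : SimpleGraph V) (K : Knowledge V T) : PMF (Knowledge V T) :=
  (smoothing ℓ G).bind fun H => (randomBroadcast K).map (deliver H K)

/-- The law of the knowledge after `r` rounds of random broadcast with `ℓ`-smoothing in
the dynamic graph `G 0, G 1, …` (`G i` is the topology of the `(i + 1)`-st round), started from the
knowledge `K₀`. The random choices of different rounds are independent. -/
def execution [Fintype V] [DecidableEq V] [Nontrivial V] [Fintype T] [DecidableEq T]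
    (ℓ : ℕ) (G : ℕ → SimpleGraph V) (K₀ : Knowledge V T) : ℕ → PMF (Knowledge V T)
  | 0 => PMF.pure K₀
  | r + 1 => (execution ℓ G K₀ r).bind (round ℓ (G r))

/-- The probability that `k`-message broadcast is not yet solved after `r` rounds of random
broadcast with `ℓ`-smoothing. (No token is ever forgotten, so solved after `r` rounds
means solved within `r` rounds.) -/
def failureProb [Fintype V] [DecidableEq V] [Nontrivial V] [Fintype T] [DecidableEq T]
    (ℓ : ℕ) (G : ℕ → SimpleGraph V) (K₀ : Knowledge V T) (r : ℕ) : ℝ≥0∞ :=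
  (execution ℓ G K₀ r).toOuterMeasure {K | ¬ Solved K}

end KBroadcast

end

/-! Each token is followed separately, with a union bound over the tokens at the end: the other
tokens matter only in that an informed node sends the given one with probability at least 1/k.
Connectivity alone gives slow growth, one new informed node per k rounds in expectation at worst
(`expect_slowPotential_le`). Growth is fast, at constant expected rate, whenever the cut around the
uninformed set has k edges (`expect_exp_uninformed_le`).

Smoothing disposes of the small cuts. A connected graph has at most 2n^k sets whose cut contains
fewer than k edges of a given spanning tree (`exists_smallCuts`). As the network is fixed in
advance, these sets are known before any coin is tossed. A fixed set of m nodes is missed by the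
token in a round with probability at most 1 - |A|m/(n²k), where A is the set of nodes informed at
the start. After enough rounds a union bound shows that every small-cut set of size at least m, for
all rounds of the next phase, has been hit (`prob_execution_smoothing_fast_le`). A later uninformed
set of size at least m is then not among them, so growth stays fast down to m.

With N about n + k³ log n, slow growth first informs N/k ≥ k² log n nodes (or half of all). One
smoothing-and-fast phase then goes below n/2 uninformed, a second below k² log n, and slow growth
finishes in O(k³ log n) rounds. All bounds come from potentials contracting in expectation and
Markov's inequality. -/

noncomputable section

namespace KBroadcast

/-! ### Expectation and probability on finite spaces -/

section Expectation

variable {α β : Type*} [Fintype α] [Fintype β]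

/-- The expectation of a real function on a finite probability space. -/
def expect (p : PMF α) (f : α → ℝ) : ℝ := ∑ a, (p a).toReal * f a

/-- The probability of an event in a finite probability space. -/
def prob (p : PMF α) (s : Set α) : ℝ := expect p (s.indicator 1)

theorem sum_toReal_eq_one (p : PMF α) : ∑ a, (p a).toReal = 1 := by
  rw [← ENNReal.toReal_sum (fun a _ => p.apply_ne_top a), ← tsum_fintype (L := .unconditional _),
    p.tsum_coe, ENNReal.toReal_one]

theorem expect_const (p : PMF α) (c : ℝ) : expect p (fun _ => c) = c := by
  simp only [expect, ← Finset.sum_mul, sum_toReal_eq_one, one_mul]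

theorem expect_pure (a : α) (f : α → ℝ) : expect (PMF.pure a) f = f a := by
  classical
  rw [expect, Finset.sum_eq_single a]
  · simp
  · intro b _ hb
    simp [PMF.pure_apply, hb]
  · simp

theorem expect_bind (p : PMF α) (q : α → PMF β) (f : β → ℝ) :
    expect (p.bind q) f = expect p fun a => expect (q a) f := by
  simp only [expect, PMF.bind_apply, tsum_fintype]
  simp_rw [Finset.mul_sum]
  rw [Finset.sum_comm]
  refine Finset.sum_congr rfl fun b _ => ?_
  rw [ENNReal.toReal_sum fun a _ => ENNReal.mul_ne_top (p.apply_ne_top a) ((q a).apply_ne_top b),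
    Finset.sum_mul]
  simp only [ENNReal.toReal_mul, mul_assoc]

theorem expect_map (p : PMF α) (g : α → β) (f : β → ℝ) :
    expect (p.map g) f = expect p (f ∘ g) := by
  rw [PMF.map, expect_bind]
  simp [expect_pure, Function.comp_def]

theorem expect_mono_support {p : PMF α} {f g : α → ℝ} (h : ∀ a ∈ p.support, f a ≤ g a) :
    expect p f ≤ expect p g := by
  refine Finset.sum_le_sum fun a _ => ?_
  by_cases ha : a ∈ p.support
  · exact mul_le_mul_of_nonneg_left (h a ha) ENNReal.toReal_nonneg
  · simp [(p.apply_eq_zero_iff a).2 ha]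

theorem expect_mono {p : PMF α} {f g : α → ℝ} (h : ∀ a, f a ≤ g a) : expect p f ≤ expect p g :=
  expect_mono_support fun a _ => h a

theorem expect_add (p : PMF α) (f g : α → ℝ) :
    expect p (fun a => f a + g a) = expect p f + expect p g := by
  simp only [expect, mul_add, Finset.sum_add_distrib]

theorem expect_const_mul (p : PMF α) (c : ℝ) (f : α → ℝ) :
    expect p (fun a => c * f a) = c * expect p f := by
  simp only [expect, Finset.mul_sum]
  exact Finset.sum_congr rfl fun a _ => by ring

theorem expect_finset_sum {ι : Type*} (p : PMF α) (s : Finset ι) (f : ι → α → ℝ) :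
    expect p (fun a => ∑ i ∈ s, f i a) = ∑ i ∈ s, expect p (f i) := by
  simp only [expect, Finset.mul_sum]
  exact Finset.sum_comm

theorem prob_le_one (p : PMF α) (s : Set α) : prob p s ≤ 1 := by
  rw [← expect_const p 1]
  exact expect_mono fun a => Set.indicator_le_self' (by simp) a

theorem prob_mono {p : PMF α} {s u : Set α} (h : s ⊆ u) : prob p s ≤ prob p u :=
  expect_mono fun a => Set.indicator_le_indicator_of_subset h (by simp) a

theorem prob_compl (p : PMF α) (s : Set α) : prob p sᶜ = 1 - prob p s := by
  rw [eq_sub_iff_add_eq, prob, prob, ← expect_add, ← expect_const p 1]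
  congr 1
  funext a
  by_cases h : a ∈ s <;> simp [h]

theorem prob_biUnion_le {ι : Type*} (p : PMF α) (s : Finset ι) (u : ι → Set α) :
    prob p (⋃ i ∈ s, u i) ≤ ∑ i ∈ s, prob p (u i) := by
  unfold prob
  rw [← expect_finset_sum]
  refine expect_mono fun a => ?_
  have h0 : ∀ i ∈ s, 0 ≤ (u i).indicator (1 : α → ℝ) a := fun i _ =>
    Set.indicator_nonneg (by simp) a
  by_cases h : a ∈ ⋃ i ∈ s, u i
  · rw [Set.indicator_of_mem h]
    obtain ⟨i, hi, hai⟩ := Set.mem_iUnion₂.1 h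
    refine le_trans ?_ (Finset.single_le_sum h0 hi)
    rw [Set.indicator_of_mem hai]
  · rw [Set.indicator_of_notMem h]
    exact Finset.sum_nonneg h0

/-- Markov's inequality. -/
theorem mul_prob_le_expect {p : PMF α} {s : Set α} {f : α → ℝ} {c : ℝ} (hf : ∀ a, 0 ≤ f a)
    (hs : ∀ a ∈ s, c ≤ f a) : c * prob p s ≤ expect p f := by
  rw [prob, ← expect_const_mul]
  refine expect_mono fun a => ?_
  by_cases h : a ∈ s
  · simpa [h] using hs a h
  · simpa [h] using hf a

theorem toOuterMeasure_eq_ofReal_prob (p : PMF α) (s : Set α) :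
    p.toOuterMeasure s = ENNReal.ofReal (prob p s) := by
  rw [PMF.toOuterMeasure_apply, tsum_fintype, prob, expect, ENNReal.ofReal_sum_of_nonneg]
  · refine Finset.sum_congr rfl fun a _ => ?_
    by_cases h : a ∈ s <;> simp [h, ENNReal.ofReal_toReal (p.apply_ne_top a)]
  · exact fun a _ => mul_nonneg ENNReal.toReal_nonneg (Set.indicator_nonneg (by simp) a)

theorem prob_uniformOfFinset (s : Finset α) (hs : s.Nonempty) (u : Set α) [DecidablePred (· ∈ u)] :
    prob (PMF.uniformOfFinset s hs) u = (s.filter (· ∈ u)).card / s.card := by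
  classical
  have h : ∀ a, ((PMF.uniformOfFinset s hs) a).toReal * u.indicator 1 a
      = if a ∈ s.filter (· ∈ u) then ((s.card : ℝ))⁻¹ else 0 := by
    intro a
    by_cases h1 : a ∈ s <;> by_cases h2 : a ∈ u <;> simp [h1, h2]
  simp only [prob, expect, h, Finset.sum_ite_mem, Finset.univ_inter, Finset.sum_const, nsmul_eq_mul]
  rw [div_eq_mul_inv]

theorem prob_bind_le {p : PMF α} {q : α → PMF β} {s : Set α} {u : Set β} {ε δ : ℝ} (hδ : 0 ≤ δ)
    (hs : prob p sᶜ ≤ ε) (hu : ∀ a ∈ s, prob (q a) u ≤ δ) : prob (p.bind q) u ≤ ε + δ := by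
  rw [prob, expect_bind]
  calc expect p (fun a => expect (q a) (u.indicator 1))
      ≤ expect p (fun a => sᶜ.indicator 1 a + δ) := by
        refine expect_mono fun a => ?_
        by_cases h : a ∈ s
        · have := hu a h
          unfold prob at this
          simpa [h] using this
        · have := prob_le_one (q a) u
          unfold prob at this
          simp only [Set.mem_compl_iff, h, not_false_eq_true, Set.indicator_of_mem, Pi.one_apply]
          linarith
    _ ≤ ε + δ := by
        rw [expect_add, expect_const]
        exact add_le_add_left hs δ

end Expectation

/-! ### Counting small cuts of a connected graph -/

section Cuts

variable {V : Type*}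

/-- A rooted breadth-first spanning tree, encoded by its parent map: the second vertex of a shortest
path to the root serves as parent. -/
theorem exists_parent {G : SimpleGraph V} (hG : G.Connected) (r : V) :
    ∃ p : V → V, ∀ v, v ≠ r → G.Adj v (p v) ∧ G.dist (p v) r < G.dist v r := by
  have h : ∀ v, ∃ w, v ≠ r → G.Adj v w ∧ G.dist w r < G.dist v r := by
    intro v
    obtain ⟨q, hq⟩ := hG.exists_walk_length_eq_dist v r
    cases q with
    | nil => exact ⟨r, fun h => absurd rfl h⟩
    | @cons _ w _ hvw q =>
      refine ⟨w, fun _ => ⟨hvw, ?_⟩⟩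
      rw [← hq, SimpleGraph.Walk.length_cons]
      exact Nat.lt_succ_of_le (SimpleGraph.dist_le q)
  choose p hp using h
  exact ⟨p, hp⟩

theorem card_filter_card_lt_le [Fintype V] [DecidableEq V] (hV : 2 ≤ Fintype.card V) (c : ℕ) :
    ((Finset.univ : Finset (Finset V)).filter fun D => D.card < c).card
      ≤ Fintype.card V ^ c := by
  have h : ((Finset.univ : Finset (Finset V)).filter fun D => D.card < c)
      = (Finset.range c).biUnion fun j => Finset.powersetCard j Finset.univ := by
    ext D
    simp [Finset.mem_powersetCard]
  rw [h]
  refine Finset.card_biUnion_le.trans ?_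
  calc ∑ j ∈ Finset.range c, (Finset.powersetCard j (Finset.univ : Finset V)).card
      ≤ ∑ j ∈ Finset.range c, Fintype.card V ^ j := by
        refine Finset.sum_le_sum fun j _ => ?_
        rw [Finset.card_powersetCard, Finset.card_univ]
        exact Nat.choose_le_pow _ _
    _ ≤ Fintype.card V ^ c := (Nat.geomSum_lt hV fun j hj => Finset.mem_range.1 hj).le

/-- A connected graph has few cuts with fewer than `c` edges. -/
theorem exists_smallCuts [Fintype V] [DecidableEq V] {G : SimpleGraph V} (hG : G.Connected)
    (hV : 2 ≤ Fintype.card V) (c : ℕ) :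
    ∃ F : Finset (Finset V), F.card ≤ 2 * Fintype.card V ^ c ∧
      ∀ M ∉ F, ∃ P : Finset (V × V), P.card = c ∧
        ∀ e ∈ P, e.1 ∈ M ∧ e.2 ∉ M ∧ G.Adj e.2 e.1 := by
  have : Nonempty V := Fintype.card_pos_iff.1 (by omega)
  obtain ⟨r⟩ := this
  obtain ⟨p, hp⟩ := exists_parent hG r
  -- The tree edges crossing the cut of M, named by their lower ends. Together with the side of the
  -- root they determine M, by descending the tree, so sets with fewer than c such edges number at
  -- most 2n^c.
  let D : Finset V → Finset V := fun M =>
    Finset.univ.filter fun v => v ≠ r ∧ ¬ (v ∈ M ↔ p v ∈ M)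
  refine ⟨Finset.univ.filter fun M => (D M).card < c, ?_, ?_⟩
  · have hinj : Set.InjOn (fun M : Finset V => (decide (r ∈ M), D M))
        ((Finset.univ.filter fun M => (D M).card < c : Finset (Finset V)) : Set (Finset V)) := by
      intro M _ M' _ h
      simp only [Prod.mk.injEq, decide_eq_decide] at h
      obtain ⟨hr, hD⟩ := h
      have key : ∀ d v, G.dist v r = d → (v ∈ M ↔ v ∈ M') := by
        intro d
        induction d using Nat.strong_induction_on with
        | _ d ih =>
          intro v hv
          by_cases hvr : v = r
          · rw [hvr]; exact hr
          · have h1 := ih _ (hv ▸ (hp v hvr).2) (p v) rfl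
            have h2 : v ∈ D M ↔ v ∈ D M' := by rw [hD]
            simp only [D, Finset.mem_filter, Finset.mem_univ, true_and, hvr, ne_eq,
              not_false_eq_true] at h2
            tauto
      ext v
      exact key _ v rfl
    calc _ ≤ ((Finset.univ : Finset Bool) ×ˢ
          ((Finset.univ : Finset (Finset V)).filter fun D => D.card < c)).card := by
          refine Finset.card_le_card_of_injOn _ ?_ hinj
          intro M hM
          simpa [em] using hM
      _ ≤ _ := by
          rw [Finset.card_product]
          simpa using card_filter_card_lt_le hV c
  · intro M hM
    simp only [Finset.mem_filter, Finset.mem_univ, true_and, not_lt] at hM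
    obtain ⟨D', hD', hc⟩ := Finset.exists_subset_card_eq hM
    have hD : ∀ v ∈ D', v ≠ r ∧ ¬ (v ∈ M ↔ p v ∈ M) := fun v hv =>
      (Finset.mem_filter.1 (hD' hv)).2
    -- Each crossing tree edge is listed with its end in M first. Distinct v give distinct edges,
    -- since two nodes cannot be each other's parent.
    refine ⟨D'.image fun v => if v ∈ M then (v, p v) else (p v, v), ?_, ?_⟩
    · rw [Finset.card_image_of_injOn, hc]
      intro v hv w hw h
      have h1 := hp v (hD v hv).1
      have h2 := hp w (hD w hw).1
      dsimp only at h
      split_ifs at h with hvM hwM hwM <;> simp only [Prod.mk.injEq] at h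
      · exact h.1
      · rw [h.2] at h1
        rw [← h.1] at h2
        omega
      · rw [h.1] at h1
        rw [← h.2] at h2
        omega
      · exact h.2
    · intro e he
      obtain ⟨v, hv, rfl⟩ := Finset.mem_image.1 he
      have h1 := hD v hv
      have h2 := (hp v h1.1).1
      by_cases hvM : v ∈ M
      · simp only [hvM, if_true]
        exact ⟨trivial, by tauto, h2.symm⟩
      · simp only [hvM, if_false]
        exact ⟨by tauto, not_false, h2⟩

end Cuts

/-! ### Monotonicity, independence and composition of rounds -/

section Dynamics

variable {V T : Type*}

theorem le_deliver [Fintype T] (H : SimpleGraph V) (K : Knowledge V T) (m : V → Option T) :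
    K ≤ deliver H K m := by
  intro v t ht
  simp [deliver, ht]

theorem le_addEdges {ℓ : ℕ} (G : SimpleGraph V) (e : Fin ℓ → PossibleEdge V) :
    G ≤ addEdges G e := le_sup_left

theorem mem_deliver [Fintype T] {H : SimpleGraph V} {K : Knowledge V T} {m : V → Option T}
    {v : V} {t : T} : t ∈ deliver H K m v ↔ t ∈ K v ∨ ∃ u, H.Adj u v ∧ m u = some t := by
  simp [deliver]

variable [Fintype V] [DecidableEq T]

/-- The nodes that know the token `t`. -/
def informed (K : Knowledge V T) (t : T) : Finset V := Finset.univ.filter fun v => t ∈ K v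

/-- The nodes that do not know the token `t`. -/
def uninformed (K : Knowledge V T) (t : T) : Finset V := Finset.univ.filter fun v => t ∉ K v

@[simp] theorem mem_informed {K : Knowledge V T} {t : T} {v : V} :
    v ∈ informed K t ↔ t ∈ K v := by simp [informed]

@[simp] theorem mem_uninformed {K : Knowledge V T} {t : T} {v : V} :
    v ∈ uninformed K t ↔ t ∉ K v := by simp [uninformed]

theorem card_informed_add_card_uninformed (K : Knowledge V T) (t : T) :
    (informed K t).card + (uninformed K t).card = Fintype.card V :=
  Finset.card_filter_add_card_filter_not _

theorem informed_mono {K K' : Knowledge V T} (h : K ≤ K') (t : T) :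
    informed K t ⊆ informed K' t := fun v hv => by
  simp only [mem_informed] at hv ⊢
  exact h v hv

theorem uninformed_anti {K K' : Knowledge V T} (h : K ≤ K') (t : T) :
    uninformed K' t ⊆ uninformed K t := fun v hv => by
  simp only [mem_uninformed] at hv ⊢
  exact fun h' => hv (h v h')

variable [DecidableEq V] [Fintype T]

/-- The probability that no node of a set of informed nodes broadcasts the token. -/
theorem prob_silent_le (K : Knowledge V T) (t : T) (A : Finset V) (hA : A ⊆ informed K t) :
    prob (randomBroadcast K) {m | ∀ u ∈ A, m u ≠ some t}
      ≤ (1 - 1 / (Fintype.card T : ℝ)) ^ A.card := by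
  classical
  rw [randomBroadcast, prob_uniformOfFinset]
  have hfilter : (Fintype.piFinset fun v => messages (K v)).filter
        (· ∈ {m : V → Option T | ∀ u ∈ A, m u ≠ some t})
      = Fintype.piFinset fun v =>
        if v ∈ A then (messages (K v)).erase (some t) else messages (K v) := by
    ext m
    simp only [Finset.mem_filter, Fintype.mem_piFinset, Set.mem_ofPred_eq]
    constructor
    · rintro ⟨h1, h2⟩ v
      split_ifs with hv
      · exact Finset.mem_erase.2 ⟨h2 v hv, h1 v⟩
      · exact h1 v
    · intro h
      refine ⟨fun v => ?_, fun u hu => ?_⟩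
      · have := h v
        split_ifs at this with hv
        · exact Finset.mem_of_mem_erase this
        · exact this
      · have := h u
        rw [if_pos hu] at this
        exact Finset.ne_of_mem_erase this
  rw [hfilter, Fintype.card_piFinset, Fintype.card_piFinset, Nat.cast_prod, Nat.cast_prod,
    ← Finset.prod_div_distrib, ← Finset.prod_const,
    ← Finset.prod_subset (Finset.subset_univ A)]
  -- A node of A avoids t with probability 1 - 1/|K v|, and |K v| ≤ k.
  · refine Finset.prod_le_prod (fun v _ => by positivity) fun v hv => ?_
    have ht : t ∈ K v := mem_informed.1 (hA hv)
    have hm : messages (K v) = (K v).image some := if_pos ⟨t, ht⟩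
    have hcard : (messages (K v)).card = (K v).card := by
      rw [hm, Finset.card_image_of_injective _ (Option.some_injective T)]
    have hpos : 0 < (K v).card := Finset.card_pos.2 ⟨t, ht⟩
    have hle : ((K v).card : ℝ) ≤ Fintype.card T := by exact_mod_cast Finset.card_le_univ _
    have hpos' : (0 : ℝ) < (K v).card := by exact_mod_cast hpos
    rw [if_pos hv, Finset.card_erase_of_mem (by rw [hm]; exact Finset.mem_image_of_mem _ ht), hcard,
      Nat.cast_pred hpos, sub_div, div_self hpos'.ne']
    exact sub_le_sub_left (one_div_le_one_div_of_le hpos' hle) 1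
  · intro v _ hv
    rw [if_neg hv, div_self]
    exact_mod_cast (Finset.card_pos.2 (messages_nonempty (K v))).ne'

variable [Nontrivial V]

theorem expect_round (ℓ : ℕ) (G : SimpleGraph V) (K : Knowledge V T) (f : Knowledge V T → ℝ) :
    expect (round ℓ G K) f
      = expect (PMF.uniformOfFintype (Fin ℓ → PossibleEdge V)) fun e =>
          expect (randomBroadcast K) fun m => f (deliver (addEdges G e) K m) := by
  classical
  rw [round, smoothing, PMF.bind_map, expect_bind]
  simp only [Function.comp_apply, expect_map]
  rfl

theorem le_of_mem_support_round {ℓ : ℕ} {G : SimpleGraph V} {K K' : Knowledge V T}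
    (h : K' ∈ (round ℓ G K).support) : K ≤ K' := by
  rw [round, PMF.mem_support_bind_iff] at h
  obtain ⟨H, _, hH⟩ := h
  rw [PMF.mem_support_map_iff] at hH
  obtain ⟨m, _, rfl⟩ := hH
  exact le_deliver H K m

theorem le_of_mem_support_execution {ℓ : ℕ} {G : ℕ → SimpleGraph V} {K : Knowledge V T} {r : ℕ} :
    ∀ {K'}, K' ∈ (execution ℓ G K r).support → K ≤ K' := by
  induction r with
  | zero =>
    intro K' h
    rw [execution, PMF.mem_support_pure_iff] at h
    exact h.ge
  | succ r ih =>
    intro K' h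
    rw [execution, PMF.mem_support_bind_iff] at h
    obtain ⟨K₁, h1, h2⟩ := h
    exact (ih h1).trans (le_of_mem_support_round h2)

theorem execution_add (ℓ : ℕ) (G : ℕ → SimpleGraph V) (K : Knowledge V T) (a b : ℕ) :
    execution ℓ G K (a + b)
      = (execution ℓ G K a).bind fun K' => execution ℓ (fun r => G (a + r)) K' b := by
  induction b with
  | zero => simp [execution]
  | succ b ih =>
    rw [← add_assoc, execution, ih, PMF.bind_bind]
    rfl

/-- A function that shrinks in expectation by a factor `ρ` in each round from all states that
know at least as much as the initial one. -/
theorem expect_execution_le {ℓ : ℕ} {G : ℕ → SimpleGraph V} {K₀ : Knowledge V T}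
    {f : Knowledge V T → ℝ} {ρ : ℝ} (hρ : 0 ≤ ρ) {L : ℕ}
    (h : ∀ r < L, ∀ K, K₀ ≤ K → expect (round ℓ (G r) K) f ≤ ρ * f K) :
    expect (execution ℓ G K₀ L) f ≤ ρ ^ L * f K₀ := by
  induction L with
  | zero => simp [execution, expect_pure]
  | succ L ih =>
    rw [execution, expect_bind]
    calc _ ≤ expect (execution ℓ G K₀ L) fun K => ρ * f K :=
          expect_mono_support fun K hK => h L (Nat.lt_succ_self L) K (le_of_mem_support_execution hK)
      _ ≤ ρ * (ρ ^ L * f K₀) := by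
          rw [expect_const_mul]
          exact mul_le_mul_of_nonneg_left (ih fun r hr => h r (hr.trans (Nat.lt_succ_self L))) hρ
      _ = _ := by ring

/-- To bound an expectation after one round it suffices to bound it for each choice of the
smoothing edges. -/
theorem expect_round_le {ℓ : ℕ} {G : SimpleGraph V} {K : Knowledge V T} {f : Knowledge V T → ℝ}
    {c : ℝ} (h : ∀ H, G ≤ H → expect (randomBroadcast K) (fun m => f (deliver H K m)) ≤ c) :
    expect (round ℓ G K) f ≤ c := by
  rw [expect_round, ← expect_const (PMF.uniformOfFintype (Fin ℓ → PossibleEdge V)) c]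
  exact expect_mono fun e => h _ (le_addEdges G e)

end Dynamics

/-! ### Two exponential estimates -/

theorem exp_neg_le_one_sub_half {z : ℝ} (h0 : 0 ≤ z) (h1 : z ≤ 1) : Real.exp (-z) ≤ 1 - z / 2 := by
  rw [Real.exp_neg]
  have h := Real.add_one_le_exp z
  refine (inv_anti₀ (by linarith) h).trans ?_
  rw [inv_le_iff_one_le_mul₀ (by linarith)]
  nlinarith

theorem one_sub_pow_le_exp {p : ℝ} (hp : p ≤ 1) (d : ℕ) :
    (1 - p) ^ d ≤ Real.exp (-(d * p)) := by
  rw [← mul_neg, Real.exp_nat_mul]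
  exact pow_le_pow_left₀ (by linarith) (Real.one_sub_le_exp_neg p) d

/-! ### One-round estimates: slow growth, fast growth, smoothing -/

section Steps

variable {V T : Type*} [Fintype V] [DecidableEq T]

theorem exists_adj_informed_uninformed {G : SimpleGraph V} (hG : G.Connected) {K : Knowledge V T}
    {t : T} (hS : (informed K t).Nonempty) (hU : (uninformed K t).Nonempty) :
    ∃ u w, t ∈ K u ∧ t ∉ K w ∧ G.Adj u w := by
  obtain ⟨u, hu⟩ := hS
  obtain ⟨w, hw⟩ := hU
  obtain ⟨q⟩ := hG.preconnected u w
  obtain ⟨d, _, h1, h2⟩ := q.exists_boundary_dart (informed K t : Set V) hu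
    (by simpa using hw)
  exact ⟨d.fst, d.snd, by simpa using h1, by simpa using h2, d.adj⟩

/-- The potential for the slow growth: it vanishes when all nodes are informed. -/
def slowPotential (t : T) (K : Knowledge V T) : ℝ :=
  if (uninformed K t).Nonempty then 2 ^ (uninformed K t).card else 0

theorem slowPotential_nonneg (t : T) (K : Knowledge V T) : 0 ≤ slowPotential t K := by
  unfold slowPotential
  split_ifs <;> positivity

theorem slowPotential_le (t : T) (K : Knowledge V T) :
    slowPotential t K ≤ 2 ^ (uninformed K t).card := by
  unfold slowPotential
  split_ifs
  · exact le_rfl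
  · positivity

variable [DecidableEq V] [Nontrivial V] [Fintype T]

/-- Some edge joins an informed u to an uninformed w. With probability at least 1/k, u sends t and
the potential at least halves; otherwise it does not grow. Once nobody is uninformed 2^0 = 1 could
not shrink further, hence the value 0 there. -/
theorem expect_slowPotential_le {ℓ : ℕ} {G : SimpleGraph V} (hG : G.Connected)
    {K : Knowledge V T} {t : T} (hS : (informed K t).Nonempty) :
    expect (round ℓ G K) (slowPotential t)
      ≤ (1 - 1 / (2 * Fintype.card T)) * slowPotential t K := by
  refine expect_round_le fun H hH => ?_
  by_cases hU : (uninformed K t).Nonempty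
  · obtain ⟨u, w, hu, hw, huw⟩ := exists_adj_informed_uninformed hG hS hU
    set c := (uninformed K t).card with hc
    have hprob := prob_silent_le K t {u} (by simpa using hu)
    rw [Finset.card_singleton, pow_one] at hprob
    have hK : slowPotential t K = 2 ^ c := if_pos hU
    have hpt : ∀ m, slowPotential t (deliver H K m)
        ≤ 2 ^ c / 2 + 2 ^ c / 2 * ({m | ∀ v ∈ ({u} : Finset V), m v ≠ some t} :
          Set (V → Option T)).indicator 1 m := by
      intro m
      refine (slowPotential_le t _).trans ?_
      by_cases hm : m u = some t
      · have hlt : (uninformed (deliver H K m) t).card + 1 ≤ c := by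
          refine Finset.card_lt_card ((Finset.ssubset_iff_of_subset
            (uninformed_anti (le_deliver H K m) t)).2 ⟨w, by simpa using hw, ?_⟩)
          rw [mem_uninformed, not_not, mem_deliver]
          exact Or.inr ⟨u, hH huw, hm⟩
        have := pow_le_pow_right₀ (one_le_two (α := ℝ)) hlt
        rw [pow_succ] at this
        simp only [Finset.mem_singleton, forall_eq, Set.mem_ofPred_eq, hm, ne_eq, not_true_eq_false,
          not_false_eq_true, Set.indicator_of_notMem, mul_zero, add_zero]
        linarith
      · have hle := Finset.card_le_card (uninformed_anti (le_deliver H K m) t)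
        have := pow_le_pow_right₀ (one_le_two (α := ℝ)) hle
        simp only [Finset.mem_singleton, forall_eq, Set.mem_ofPred_eq, hm, ne_eq,
          not_false_eq_true, Set.indicator_of_mem, Pi.one_apply]
        linarith
    refine (expect_mono hpt).trans ?_
    rw [expect_add, expect_const, expect_const_mul, hK]
    have h2 : (0 : ℝ) < 2 ^ c := by positivity
    calc _ ≤ (2 : ℝ) ^ c / 2 + 2 ^ c / 2 * (1 - 1 / (Fintype.card T : ℝ)) :=
          add_le_add_right (mul_le_mul_of_nonneg_left hprob (by positivity)) _
      _ = _ := by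
          rw [one_div, one_div, mul_inv]
          ring
  · have h0 : slowPotential t K = 0 := if_neg hU
    rw [h0, mul_zero, ← expect_const (randomBroadcast K) 0]
    refine expect_mono fun m => (if_neg fun h => hU ?_).le
    exact h.mono (uninformed_anti (le_deliver H K m) t)

/-- If many edges cross the cut between informed and uninformed nodes, then their number shrinks
quickly. -/
theorem expect_exp_uninformed_le {ℓ : ℕ} {G : SimpleGraph V} {K : Knowledge V T} {t : T}
    {P : Finset (V × V)} (hP : P.card = Fintype.card T)
    (hcut : ∀ e ∈ P, e.1 ∈ uninformed K t ∧ e.2 ∉ uninformed K t ∧ G.Adj e.2 e.1) :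
    expect (round ℓ G K) (fun K' => Real.exp ((uninformed K' t).card / Fintype.card T))
      ≤ (1 - 1 / (4 * Fintype.card T)) * Real.exp ((uninformed K t).card / Fintype.card T) := by
  refine expect_round_le fun H hH => ?_
  set k := Fintype.card T with hk
  have hk1 : 1 ≤ k := Fintype.card_pos_iff.2 ⟨t⟩
  have hkr : (1 : ℝ) ≤ k := by exact_mod_cast hk1
  set W := P.image Prod.fst with hW
  -- The informed neighbours of w along P; their numbers d add up to k.
  let Q : V → Finset V := fun w => (P.filter fun e => e.1 = w).image Prod.snd
  have hQ : ∀ w u, u ∈ Q w ↔ (w, u) ∈ P := by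
    intro w u
    simp only [Q, Finset.mem_image, Finset.mem_filter, Prod.exists]
    constructor
    · rintro ⟨a, b, ⟨h, rfl⟩, rfl⟩
      exact h
    · exact fun h => ⟨w, u, ⟨h, rfl⟩, rfl⟩
  have hQcard : ∀ w, (Q w).card = (P.filter fun e => e.1 = w).card := by
    intro w
    refine Finset.card_image_of_injOn fun a ha b hb h => Prod.ext ?_ h
    rw [(Finset.mem_filter.1 ha).2, (Finset.mem_filter.1 hb).2]
  have hsum : ∑ w ∈ W, (Q w).card = k := by
    simp_rw [hQcard]
    rw [← hP, hW]
    exact (Finset.card_eq_sum_card_image Prod.fst P).symm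
  let silent : V → Set (V → Option T) := fun w => {m | ∀ u ∈ Q w, m u ≠ some t}
  -- w learns t with probability at least 1 - (1 - 1/k)^d ≥ 1 - exp(-d/k) ≥ d/(2k), as d ≤ k. Summed
  -- over W, at least 1/2 node is gained in expectation.
  have hsilent : ∀ w ∈ W, (Q w).card / (2 * k : ℝ) ≤ prob (randomBroadcast K) (silent w)ᶜ := by
    intro w hw
    rw [prob_compl]
    have h1 : prob (randomBroadcast K) (silent w) ≤ (1 - 1 / (k : ℝ)) ^ (Q w).card := by
      refine prob_silent_le K t (Q w) fun u hu => ?_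
      have := (hcut _ ((hQ w u).1 hu)).2.1
      simpa using this
    have hd : (Q w).card ≤ k := by
      rw [← hsum]
      exact Finset.single_le_sum (f := fun w => (Q w).card) (fun _ _ => Nat.zero_le _) hw
    have hdr : ((Q w).card : ℝ) ≤ k := by exact_mod_cast hd
    have h2 := one_sub_pow_le_exp (p := 1 / (k : ℝ)) ((div_le_one (by linarith)).2 hkr) (Q w).card
    have h3 := exp_neg_le_one_sub_half (z := (Q w).card * (1 / (k : ℝ))) (by positivity)
      (by rw [mul_one_div]; exact (div_le_one (by linarith)).2 hdr)
    have h4 : (Q w).card * (1 / (k : ℝ)) / 2 = (Q w).card / (2 * k : ℝ) := by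
      field_simp
    linarith
  have hpt : ∀ m, Real.exp ((uninformed (deliver H K m) t).card / k)
      ≤ Real.exp ((uninformed K t).card / k)
        + -(Real.exp ((uninformed K t).card / k) / (2 * k))
          * ∑ w ∈ W, (silent w)ᶜ.indicator 1 m := by
    intro m
    classical
    set B := W.filter fun w => m ∈ (silent w)ᶜ with hB
    have hBsum : ∑ w ∈ W, (silent w)ᶜ.indicator (1 : (V → Option T) → ℝ) m = B.card := by
      rw [hB, Finset.card_filter, Nat.cast_sum]
      refine Finset.sum_congr rfl fun w _ => ?_
      by_cases h : m ∈ (silent w)ᶜ <;> simp [Set.indicator, h]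
    -- Taking exactly k edges caps the counted gain at k, so exp(-|B|/k) can be linearized.
    have hBk : (B.card : ℝ) ≤ k := by
      have h1 : B.card ≤ W.card := Finset.card_filter_le _ _
      have h2 : W.card ≤ P.card := Finset.card_image_le
      exact_mod_cast (h1.trans h2).trans_eq hP
    have hBcard : B.card + (uninformed (deliver H K m) t).card ≤ (uninformed K t).card := by
      rw [← Finset.card_union_of_disjoint]
      · refine Finset.card_le_card (Finset.union_subset (fun w hw => ?_)
          (uninformed_anti (le_deliver H K m) t))
        obtain ⟨e, he, rfl⟩ := Finset.mem_image.1 (Finset.mem_filter.1 hw).1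
        exact (hcut e he).1
      · rw [Finset.disjoint_left]
        intro w hw
        have hw' := (Finset.mem_filter.1 hw).2
        simp only [silent, Set.mem_compl_iff, Set.mem_ofPred_eq, not_forall, not_not] at hw'
        obtain ⟨u, hu, hmu⟩ := hw'
        rw [mem_uninformed, not_not, mem_deliver]
        exact Or.inr ⟨u, hH (hcut _ ((hQ w u).1 hu)).2.2, hmu⟩
    have hBcard' : (B.card : ℝ) + (uninformed (deliver H K m) t).card ≤ (uninformed K t).card := by
      exact_mod_cast hBcard
    have hexp := exp_neg_le_one_sub_half (z := (B.card : ℝ) / k) (by positivity)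
      ((div_le_one (by linarith)).2 hBk)
    rw [hBsum]
    calc Real.exp ((uninformed (deliver H K m) t).card / k)
        ≤ Real.exp ((uninformed K t).card / k + -(B.card / k)) := by
          rw [Real.exp_le_exp, ← sub_eq_add_neg, ← sub_div]
          exact div_le_div_of_nonneg_right (by linarith) (by linarith)
      _ ≤ Real.exp ((uninformed K t).card / k) * (1 - B.card / k / 2) := by
          rw [Real.exp_add]
          exact mul_le_mul_of_nonneg_left hexp (Real.exp_nonneg _)
      _ = _ := by field_simp; ring
  refine (expect_mono hpt).trans ?_
  rw [expect_add, expect_const, expect_const_mul, expect_finset_sum]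
  have hge : (1 : ℝ) / 2 ≤ ∑ w ∈ W, expect (randomBroadcast K) ((silent w)ᶜ.indicator 1) := by
    refine le_trans (le_of_eq ?_) (Finset.sum_le_sum hsilent)
    rw [← Finset.sum_div, ← Nat.cast_sum, hsum]
    field_simp
  have := mul_le_mul_of_nonneg_left hge
    (show 0 ≤ Real.exp ((uninformed K t).card / k) / (2 * k) by positivity)
  have h5 : (1 - 1 / (4 * (k : ℝ))) * Real.exp ((uninformed K t).card / k)
      = Real.exp ((uninformed K t).card / k)
        - Real.exp ((uninformed K t).card / k) / (2 * k) * (1 / 2) := by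
    field_simp
    ring
  rw [h5]
  linarith

/-- The probability that a uniformly random edge crosses between two disjoint sets. -/
theorem prob_crossing_ge {A M : Finset V} (h : Disjoint A M) :
    (A.card * M.card : ℝ) / Fintype.card V ^ 2
      ≤ prob (PMF.uniformOfFintype (Fin 1 → PossibleEdge V))
          {e | ∃ u ∈ A, ∃ v ∈ M, (e 0 : Sym2 V) = s(u, v)} := by
  classical
  have hne : ∀ q ∈ A ×ˢ M, q.1 ≠ q.2 := fun q hq h' => by
    rw [Finset.mem_product] at hq
    exact Finset.disjoint_left.1 h hq.1 (h' ▸ hq.2)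
  rw [PMF.uniformOfFintype, prob_uniformOfFinset]
  have hcard : ((Finset.univ : Finset (Fin 1 → PossibleEdge V)).card : ℝ)
      ≤ Fintype.card V ^ 2 := by
    have h1 : (Finset.univ : Finset (Fin 1 → PossibleEdge V)).card = (Fintype.card V).choose 2 := by
      rw [Finset.card_univ, Fintype.card_fun, Fintype.card_fin, pow_one,
        ← SimpleGraph.card_edgeFinset_top_eq_card_choose_two, SimpleGraph.edgeFinset_card]
    rw [h1]
    exact_mod_cast Nat.choose_le_pow _ _
  have hpos : (0 : ℝ) < (Finset.univ : Finset (Fin 1 → PossibleEdge V)).card := by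
    exact_mod_cast Finset.card_pos.2 Finset.univ_nonempty
  refine le_trans (div_le_div_of_nonneg_left (by positivity) hpos hcard) ?_
  refine div_le_div_of_nonneg_right ?_ hpos.le
  rw [← Nat.cast_mul, ← Finset.card_product, Nat.cast_le]
  refine Finset.card_le_card_of_injOn
    -- The default is never used on A × M, and disjointness lets the ordered pair be recovered from
    -- the edge.
    (fun q _ => if hq : q.1 ≠ q.2 then ⟨s(q.1, q.2), by simpa using hq⟩ else Classical.arbitrary _)
    ?_ ?_
  · intro q hq
    have hq' := Finset.mem_product.1 hq
    simp only [Finset.coe_filter, Finset.mem_univ, true_and, Set.mem_ofPred_eq]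
    exact ⟨q.1, hq'.1, q.2, hq'.2, by rw [dif_pos (hne q hq)]⟩
  · intro q hq q' hq' heq
    have h0 := congrArg Subtype.val (congrFun heq 0)
    simp only [dif_pos (hne q hq), dif_pos (hne q' hq')] at h0
    have h1 := Finset.mem_product.1 hq
    have h2 := Finset.mem_product.1 hq'
    rcases Sym2.eq_iff.1 h0 with ⟨h3, h4⟩ | ⟨h3, h4⟩
    · exact Prod.ext h3 h4
    · exact absurd (h3 ▸ h1.1) fun h5 => Finset.disjoint_left.1 h h5 h2.2

/-- The smoothing edges make it unlikely that a fixed large set remains uninformed. -/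
theorem prob_round_disjoint_le {G : SimpleGraph V} {K₀ K : Knowledge V T} (hK : K₀ ≤ K) {t : T}
    (M : Finset V) :
    prob (round 1 G K) {K' | Disjoint (informed K' t) M}
      ≤ (1 - (informed K₀ t).card * M.card / (Fintype.card V ^ 2 * Fintype.card T))
        * ({K' | Disjoint (informed K' t) M} : Set (Knowledge V T)).indicator 1 K := by
  classical
  by_cases hM : Disjoint (informed K t) M
  · rw [Set.indicator_of_mem (by exact hM), Pi.one_apply, mul_one, prob, expect_round]
    set k := Fintype.card T with hk
    set E : Set (Fin 1 → PossibleEdge V) :=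
      {e | ∃ u ∈ informed K₀ t, ∃ v ∈ M, (e 0 : Sym2 V) = s(u, v)} with hE
    have hcross := prob_crossing_ge (hM.mono_left (informed_mono hK t))
    -- Only edges from the initially informed set are used, so the rate is the same in every round
    -- of a phase. Given such an edge, its informed end stays silent with probability at most 1 -
    -- 1/k.
    calc _ ≤ expect (PMF.uniformOfFintype (Fin 1 → PossibleEdge V))
            fun e => 1 + -(1 / (k : ℝ)) * E.indicator 1 e := by
          refine expect_mono fun e => ?_
          by_cases he : e ∈ E
          · rw [Set.indicator_of_mem he, Pi.one_apply, mul_one, ← sub_eq_add_neg]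
            obtain ⟨u, hu, v, hv, huv⟩ := he
            have hprob := prob_silent_le K t {u} (by simpa using informed_mono hK t hu)
            rw [Finset.card_singleton, pow_one] at hprob
            refine le_trans ?_ hprob
            refine expect_mono fun m => ?_
            by_cases hm : m u = some t
            · rw [Set.indicator_of_notMem]
              · exact Set.indicator_nonneg (by simp) m
              · intro hd
                refine Finset.disjoint_left.1 hd (mem_informed.2 (mem_deliver.2
                  (Or.inr ⟨u, ?_, hm⟩))) hv
                refine Or.inr ?_
                rw [SimpleGraph.fromEdgeSet_adj]
                refine ⟨⟨0, huv⟩, ?_⟩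
                rintro rfl
                exact Finset.disjoint_left.1 hM (informed_mono hK t hu) hv
            · rw [Set.indicator_of_mem (s := {m : V → Option T | ∀ v ∈ ({u} : Finset V), m v ≠ some t})
                (by simpa using hm)]
              exact Set.indicator_le_self' (by simp) _
          · rw [Set.indicator_of_notMem he, mul_zero, add_zero,
              ← expect_const (randomBroadcast K) 1]
            exact expect_mono fun m => Set.indicator_le_self' (by simp) _
      _ = 1 - 1 / k * prob (PMF.uniformOfFintype (Fin 1 → PossibleEdge V)) E := by
          rw [expect_add, expect_const, expect_const_mul, prob]
          ring
      _ ≤ _ := by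
          have := mul_le_mul_of_nonneg_left hcross (show (0 : ℝ) ≤ 1 / k by positivity)
          have h2 : ((informed K₀ t).card * M.card / (Fintype.card V ^ 2 * k) : ℝ)
            = 1 / k * ((informed K₀ t).card * M.card / Fintype.card V ^ 2) := by
            rw [div_mul_div_comm, one_mul, mul_comm (k : ℝ)]
          rw [h2]
          linarith
  · rw [Set.indicator_of_notMem (by exact hM), mul_zero, prob,
      ← expect_const (round 1 G K) 0]
    refine expect_mono_support fun K' hK' => ?_
    rw [Set.indicator_of_notMem]
    exact fun h => hM (Disjoint.mono_left (informed_mono (le_of_mem_support_round hK') t) h)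

end Steps

/-! ### Iterating the estimates over a phase -/

section Phases

variable {V T : Type*} [Fintype V] [DecidableEq V] [Nontrivial V] [Fintype T] [DecidableEq T]

theorem expect_execution_slowPotential_le {ℓ : ℕ} {G : ℕ → SimpleGraph V}
    (hG : ∀ r, (G r).Connected) {K₀ : Knowledge V T} {t : T} (hS : (informed K₀ t).Nonempty)
    (L : ℕ) :
    expect (execution ℓ G K₀ L) (slowPotential t)
      ≤ Real.exp (-(L * (1 / (2 * Fintype.card T)))) * 2 ^ (uninformed K₀ t).card := by
  have hk : (1 : ℝ) ≤ Fintype.card T := by exact_mod_cast Fintype.card_pos_iff.2 ⟨t⟩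
  have hp : 1 / (2 * (Fintype.card T : ℝ)) ≤ 1 := (div_le_one (by linarith)).2 (by linarith)
  refine (expect_execution_le (f := slowPotential t) (sub_nonneg.2 hp) fun r _ K hK =>
    expect_slowPotential_le (hG r) (hS.mono (informed_mono hK t))).trans ?_
  exact mul_le_mul (one_sub_pow_le_exp hp L) (slowPotential_le t K₀) (slowPotential_nonneg t K₀)
    (Real.exp_nonneg _)

theorem prob_execution_disjoint_le (G : ℕ → SimpleGraph V) (K₀ : Knowledge V T) (t : T)
    (M : Finset V) (L : ℕ) :
    prob (execution 1 G K₀ L) {K | Disjoint (informed K t) M}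
      ≤ Real.exp (-(L *
        ((informed K₀ t).card * M.card / (Fintype.card V ^ 2 * Fintype.card T)))) := by
  have hk : (1 : ℝ) ≤ Fintype.card T := by exact_mod_cast Fintype.card_pos_iff.2 ⟨t⟩
  have hn : (0 : ℝ) < Fintype.card V := by exact_mod_cast Fintype.card_pos
  have hA : ((informed K₀ t).card : ℝ) ≤ Fintype.card V := by exact_mod_cast Finset.card_le_univ _
  have hM : (M.card : ℝ) ≤ Fintype.card V := by exact_mod_cast Finset.card_le_univ _
  have hp : ((informed K₀ t).card * M.card / (Fintype.card V ^ 2 * Fintype.card T) : ℝ) ≤ 1 := by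
    rw [div_le_one (by positivity)]
    calc _ ≤ (Fintype.card V * Fintype.card V : ℝ) := by gcongr
      _ ≤ _ := by nlinarith [mul_pos hn hn]
  refine (expect_execution_le (sub_nonneg.2 hp) fun r _ K hK =>
    prob_round_disjoint_le hK M).trans ?_
  refine (mul_le_of_le_one_right (pow_nonneg (sub_nonneg.2 hp) L) ?_).trans
    (one_sub_pow_le_exp hp L)
  exact Set.indicator_le_self' (by simp) _

/-- The potential for the fast growth: it vanishes once less than `m` nodes are uninformed. -/
def fastPotential (t : T) (m : ℝ) (K : Knowledge V T) : ℝ :=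
  open Classical in
  if m ≤ (uninformed K t).card then Real.exp ((uninformed K t).card / Fintype.card T) else 0

/-- The fast growth lasts as long as the uninformed nodes do not form one of the few sets with a
small cut. -/
theorem prob_execution_fast_le {ℓ : ℕ} {G : ℕ → SimpleGraph V} {K₀ : Knowledge V T} {t : T}
    {m : ℝ} {L : ℕ} {F : ℕ → Finset (Finset V)}
    (hF : ∀ r, ∀ M ∉ F r, ∃ P : Finset (V × V), P.card = Fintype.card T ∧
      ∀ e ∈ P, e.1 ∈ M ∧ e.2 ∉ M ∧ (G r).Adj e.2 e.1)
    (h : ∀ r < L, ∀ M ∈ F r, m ≤ M.card → ¬ Disjoint (informed K₀ t) M) :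
    prob (execution ℓ G K₀ L) {K | m ≤ (uninformed K t).card}
      ≤ Real.exp ((Fintype.card V - L / 4) / Fintype.card T) := by
  have hk : (1 : ℝ) ≤ Fintype.card T := by exact_mod_cast Fintype.card_pos_iff.2 ⟨t⟩
  have hp : 1 / (4 * (Fintype.card T : ℝ)) ≤ 1 := (div_le_one (by linarith)).2 (by linarith)
  have hnonneg : ∀ K : Knowledge V T, 0 ≤ fastPotential t m K := fun K => by
    unfold fastPotential
    split_ifs <;> positivity
  have hle : ∀ K : Knowledge V T,
      fastPotential t m K ≤ Real.exp ((uninformed K t).card / Fintype.card T) := fun K => by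
    unfold fastPotential
    split_ifs
    · exact le_rfl
    · positivity
  have hstep : ∀ r < L, ∀ K, K₀ ≤ K → expect (round ℓ (G r) K) (fastPotential t m)
      ≤ (1 - 1 / (4 * Fintype.card T)) * fastPotential t m K := by
    intro r hr K hK
    by_cases hm : m ≤ (uninformed K t).card
    -- The current uninformed set is disjoint from the initially informed one, so by `h` it cannot
    -- be a small-cut set.
    · obtain ⟨P, hP, hcut⟩ := hF r (uninformed K t) fun hmem => by
        refine h r hr _ hmem hm (Finset.disjoint_left.2 fun v hv => ?_)
        rw [mem_uninformed, not_not]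
        exact mem_informed.1 (informed_mono hK t hv)
      have hfK : fastPotential t m K = Real.exp ((uninformed K t).card / Fintype.card T) :=
        if_pos hm
      rw [hfK]
      exact (expect_mono hle).trans (expect_exp_uninformed_le hP hcut)
    · have hfK : fastPotential t m K = 0 := if_neg hm
      rw [hfK, mul_zero, ← expect_const (round ℓ (G r) K) 0]
      refine expect_mono_support fun K' hK' => (if_neg fun hm' => hm (hm'.trans ?_)).le
      exact_mod_cast Finset.card_le_card (uninformed_anti (le_of_mem_support_round hK') t)
  have hmarkov := mul_prob_le_expect (p := execution ℓ G K₀ L)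
    (s := {K | m ≤ (uninformed K t).card}) (c := 1) hnonneg fun K hK => by
      have hfK : fastPotential t m K = Real.exp ((uninformed K t).card / Fintype.card T) :=
        if_pos hK
      rw [hfK]
      exact Real.one_le_exp (by positivity)
  rw [one_mul] at hmarkov
  refine hmarkov.trans ((expect_execution_le (sub_nonneg.2 hp) hstep).trans ?_)
  have hU : ((uninformed K₀ t).card : ℝ) ≤ Fintype.card V := by
    exact_mod_cast Finset.card_le_univ _
  calc _ ≤ Real.exp (-(L * (1 / (4 * (Fintype.card T : ℝ)))))
        * Real.exp (Fintype.card V / Fintype.card T) := by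
        refine mul_le_mul (one_sub_pow_le_exp hp L) ((hle K₀).trans ?_) (hnonneg K₀)
          (Real.exp_nonneg _)
        rw [Real.exp_le_exp]
        gcongr
    _ = _ := by
        rw [← Real.exp_add]
        congr 1
        field_simp
        ring

/-- A phase that collects smoothing edges followed by a phase of fast growth. -/
theorem prob_execution_smoothing_fast_le {G : ℕ → SimpleGraph V} (hG : ∀ r, (G r).Connected)
    (K₀ : Knowledge V T) (t : T) (m : ℝ) (L L' : ℕ) :
    prob (execution 1 G K₀ (L + L')) {K | m ≤ (uninformed K t).card}
      ≤ L' * (2 * (Fintype.card V : ℝ) ^ Fintype.card T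
          * Real.exp (-(L * ((informed K₀ t).card * m / (Fintype.card V ^ 2 * Fintype.card T)))))
        + Real.exp ((Fintype.card V - L' / 4) / Fintype.card T) := by
  classical
  have hF : ∀ r, ∃ F : Finset (Finset V), F.card ≤ 2 * Fintype.card V ^ Fintype.card T ∧
      ∀ M ∉ F, ∃ P : Finset (V × V), P.card = Fintype.card T ∧
        ∀ e ∈ P, e.1 ∈ M ∧ e.2 ∉ M ∧ (G (L + r)).Adj e.2 e.1 :=
    fun r => exists_smallCuts (hG (L + r)) Fintype.one_lt_card (Fintype.card T)
  choose F hFcard hFcut using hF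
  rw [execution_add]
  refine prob_bind_le
    (s := {K | ∀ r < L', ∀ M ∈ F r, m ≤ M.card → ¬ Disjoint (informed K t) M})
    (Real.exp_nonneg _) ?_ fun K hK => prob_execution_fast_le hFcut hK
  have hsub : ({K | ∀ r < L', ∀ M ∈ F r, m ≤ M.card → ¬ Disjoint (informed K t) M} :
        Set (Knowledge V T))ᶜ
      ⊆ ⋃ r ∈ Finset.range L', ⋃ M ∈ (F r).filter fun M => m ≤ M.card,
        {K | Disjoint (informed K t) M} := by
    intro K hK
    simp only [Set.mem_compl_iff, Set.mem_ofPred_eq, not_forall, not_not] at hK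
    obtain ⟨r, hr, M, hM, hm, hd⟩ := hK
    simp only [Set.mem_iUnion]
    exact ⟨r, Finset.mem_range.2 hr, M, Finset.mem_filter.2 ⟨hM, hm⟩, hd⟩
  refine (prob_mono hsub).trans ((prob_biUnion_le _ _ _).trans ?_)
  rw [← nsmul_eq_mul, ← Finset.card_range L', ← Finset.sum_const, Finset.card_range]
  refine Finset.sum_le_sum fun r _ => (prob_biUnion_le _ _ _).trans ?_
  refine (Finset.sum_le_card_nsmul _ _
    (Real.exp (-(L * ((informed K₀ t).card * m / (Fintype.card V ^ 2 * Fintype.card T)))))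
    fun M hM => ?_).trans ?_
  · refine (prob_execution_disjoint_le G K₀ t M L).trans ?_
    rw [Real.exp_le_exp, neg_le_neg_iff]
    have := (Finset.mem_filter.1 hM).2
    gcongr
  · rw [nsmul_eq_mul]
    refine mul_le_mul_of_nonneg_right ?_ (Real.exp_nonneg _)
    exact_mod_cast (Finset.card_filter_le _ _).trans (hFcard r)

end Phases

/-! ### Choice of phase lengths and the bound for one token -/

section Assembly

variable {V T : Type*} [Fintype V] [DecidableEq V] [Nontrivial V] [Fintype T] [DecidableEq T]

/-- `hm` makes the smoothing exponent at least (2y+9)k log n, which beats the union bound over 2n^k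
sets per round; `hN` and `hN'` make the fast growth finish. -/
theorem prob_phase_le {G : ℕ → SimpleGraph V} (hG : ∀ r, (G r).Connected)
    (K₀ : Knowledge V T) (t : T) (m : ℝ) (y N : ℕ) (hN : Fintype.card V ≤ N)
    (hN' : (Fintype.card T : ℝ) ^ 3 * Real.log (Fintype.card V) ≤ N)
    (hN5 : N ≤ Fintype.card V ^ 5)
    (hm : (Fintype.card T : ℝ) ^ 2 * Real.log (Fintype.card V) * Fintype.card V ^ 2
      ≤ 4 * ((informed K₀ t).card * m) * N) :
    prob (execution 1 G K₀ (4 * (2 * y + 9) * N + 4 * (y + 1) * N))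
        {K | m ≤ (uninformed K t).card}
      ≤ 2 * Real.exp (-(y * Real.log (Fintype.card V))) := by
  refine (prob_execution_smoothing_fast_le hG K₀ t m _ _).trans ?_
  have hn2 : 2 ≤ Fintype.card V := Fintype.one_lt_card
  have hk1 : 1 ≤ Fintype.card T := Fintype.card_pos_iff.2 ⟨t⟩
  generalize Fintype.card V = n at *
  generalize Fintype.card T = k at *
  generalize ((informed K₀ t).card : ℝ) * m = q at *
  have hn0 : (0 : ℝ) < n := by exact_mod_cast (by omega : 0 < n)
  have hk : (1 : ℝ) ≤ k := by exact_mod_cast hk1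
  have hlog : 0 ≤ Real.log n := Real.log_natCast_nonneg n
  have hNr : (n : ℝ) ≤ N := by exact_mod_cast hN
  -- The exponent is (y+2) + 5 + (1+k), from 4(y+1), N and 2n^k; adding y to it gives at most
  -- (2y+9)k.
  have h1 : ((4 * (y + 1) * N : ℕ) : ℝ) * (2 * (n : ℝ) ^ k)
      ≤ Real.exp ((y + 8 + k) * Real.log n) := by
    have hy : 4 * (y + 1) ≤ n ^ (y + 2) := by
      calc 4 * (y + 1) ≤ 4 * 2 ^ y := Nat.mul_le_mul_left 4 Nat.lt_two_pow_self
        _ = 2 ^ (y + 2) := by ring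
        _ ≤ n ^ (y + 2) := Nat.pow_le_pow_left hn2 _
    have h2 : 4 * (y + 1) * N * (2 * n ^ k) ≤ n ^ (y + 8 + k) := by
      calc 4 * (y + 1) * N * (2 * n ^ k) ≤ n ^ (y + 2) * n ^ 5 * (n * n ^ k) := by gcongr
        _ = n ^ (y + 8 + k) := by ring
    have h3 : Real.exp ((y + 8 + k) * Real.log n) = ((n ^ (y + 8 + k) : ℕ) : ℝ) := by
      rw [show (y + 8 + k : ℝ) = ((y + 8 + k : ℕ) : ℝ) by push_cast; ring, Real.exp_nat_mul,
        Real.exp_log hn0, Nat.cast_pow]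
    rw [h3]
    exact_mod_cast h2
  have h2 : (2 * y + 9) * (k * Real.log n)
      ≤ ((4 * (2 * y + 9) * N : ℕ) : ℝ) * (q / (n ^ 2 * k)) := by
    have h3 : k * Real.log n ≤ 4 * N * (q / (n ^ 2 * k)) := by
      rw [mul_div_assoc', le_div_iff₀ (by positivity)]
      linarith
    calc _ ≤ (2 * y + 9 : ℝ) * (4 * N * (q / (n ^ 2 * k))) := by gcongr
      _ = _ := by push_cast; ring
  have hkl : Real.log n ≤ k * Real.log n := le_mul_of_one_le_left hlog hk
  rw [two_mul (Real.exp _)]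
  refine add_le_add ?_ ?_
  · rw [← mul_assoc]
    refine (mul_le_mul_of_nonneg_right h1 (Real.exp_nonneg _)).trans ?_
    rw [← Real.exp_add, Real.exp_le_exp]
    nlinarith [mul_le_mul_of_nonneg_left hkl (show (0 : ℝ) ≤ 2 * y + 8 by positivity)]
  · rw [Real.exp_le_exp, div_le_iff₀ (by linarith)]
    have h3 : Real.log n * k ≤ N := by
      refine le_trans ?_ hN'
      rw [mul_comm]
      gcongr
      exact le_self_pow₀ hk (by norm_num)
    have h4 := mul_le_mul_of_nonneg_left h3 (Nat.cast_nonneg (α := ℝ) y)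
    push_cast
    linarith

theorem prob_execution_few_informed_le {G : ℕ → SimpleGraph V} (hG : ∀ r, (G r).Connected)
    {K₀ : Knowledge V T} {t : T} (hS : (informed K₀ t).Nonempty) (y N : ℕ)
    (hN' : (Fintype.card T : ℝ) ^ 3 * Real.log (Fintype.card V) ≤ N) :
    prob (execution 1 G K₀ (4 * y * N))
        {K | Fintype.card V ≤ 2 * ((informed K t).card : ℝ) ∨
          y * N / (Fintype.card T : ℝ) ≤ (informed K t).card}ᶜ
      ≤ Real.exp (-(y * Real.log (Fintype.card V))) := by
  have hk : (1 : ℝ) ≤ Fintype.card T := by exact_mod_cast Fintype.card_pos_iff.2 ⟨t⟩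
  have hn : (0 : ℝ) < Fintype.card V := by exact_mod_cast Fintype.card_pos
  have hlog : 0 ≤ Real.log (Fintype.card V) := Real.log_natCast_nonneg _
  set n := Fintype.card V with hn_def
  set k := Fintype.card T with hk_def
  have hpow : ∀ j : ℕ, (2 : ℝ) ^ j ≤ Real.exp j := fun j => by
    rw [← Real.exp_one_pow]
    exact pow_le_pow_left₀ zero_le_two (by linarith [Real.add_one_le_exp 1]) j
  have hmarkov := mul_prob_le_expect (p := execution 1 G K₀ (4 * y * N))
    (s := {K | n ≤ 2 * ((informed K t).card : ℝ) ∨ y * N / (k : ℝ) ≤ (informed K t).card}ᶜ)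
    -- With s < yN/k nodes informed and some node uninformed the potential is 2^(n-s), which exceeds
    -- this c, while its expectation is at most 2^n exp(-2yN/k).
    (c := 2 ^ n * Real.exp (-(y * N / k))) (slowPotential_nonneg t) fun K hK => by
      simp only [Set.mem_compl_iff, Set.mem_ofPred_eq, not_or, not_le] at hK
      have hcard := card_informed_add_card_uninformed K t
      have hU : (uninformed K t).Nonempty := by
        rw [← Finset.card_pos]
        by_contra h0
        have : (informed K t).card = n := by omega
        rw [this] at hK
        linarith
      have hval : slowPotential t K = 2 ^ (uninformed K t).card := if_pos hU
      rw [hval, hn_def, ← hcard, pow_add, mul_right_comm]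
      refine mul_le_of_le_one_left (by positivity) ?_
      calc _ ≤ Real.exp (informed K t).card * Real.exp (-(y * N / k)) := by
            gcongr
            exact hpow _
        _ ≤ 1 := by
            rw [← Real.exp_add, Real.exp_le_one_iff]
            linarith
  have hexp := hmarkov.trans (expect_execution_slowPotential_le hG hS _)
  have hU0 : (2 : ℝ) ^ (uninformed K₀ t).card ≤ 2 ^ n :=
    pow_le_pow_right₀ one_le_two (Finset.card_le_univ _)
  have hexp2 : 2 ^ n * Real.exp (-(y * N / k)) *
      prob (execution 1 G K₀ (4 * y * N))
        {K | n ≤ 2 * ((informed K t).card : ℝ) ∨ y * N / (k : ℝ) ≤ (informed K t).card}ᶜ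
      ≤ 2 ^ n * Real.exp (-(y * N / k)) * Real.exp (-(y * N / k)) := by
    refine hexp.trans ((mul_le_mul_of_nonneg_left hU0 (Real.exp_nonneg _)).trans_eq ?_)
    rw [mul_assoc (2 ^ n : ℝ), ← Real.exp_add, mul_comm]
    congr 2
    rw [← hk_def]
    push_cast
    field_simp
    ring
  refine (le_of_mul_le_mul_left hexp2 (by positivity)).trans ?_
  rw [Real.exp_le_exp, neg_le_neg_iff, mul_div_assoc]
  refine mul_le_mul_of_nonneg_left ?_ (Nat.cast_nonneg y)
  rw [le_div_iff₀ (by linarith), mul_comm]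
  refine le_trans ?_ hN'
  gcongr
  exact le_self_pow₀ hk (by norm_num)

/-- The potential starts at most at exp(k² log n) and decays by exp(-L/(2k)), where L/(2k) ≥ (y+1)k²
log n. -/
theorem prob_execution_uninformed_le {G : ℕ → SimpleGraph V} (hG : ∀ r, (G r).Connected)
    {K₀ : Knowledge V T} {t : T} (hS : (informed K₀ t).Nonempty) (y N L : ℕ)
    (hN' : (Fintype.card T : ℝ) ^ 3 * Real.log (Fintype.card V) ≤ N)
    (hL : 2 * (y + 1) * N ≤ L)
    (hU : ((uninformed K₀ t).card : ℝ) ≤ Fintype.card T ^ 2 * Real.log (Fintype.card V)) :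
    prob (execution 1 G K₀ L) {K | (uninformed K t).Nonempty}
      ≤ Real.exp (-(y * Real.log (Fintype.card V))) := by
  have hk : (1 : ℝ) ≤ Fintype.card T := by exact_mod_cast Fintype.card_pos_iff.2 ⟨t⟩
  have hlog : 0 ≤ Real.log (Fintype.card V) := Real.log_natCast_nonneg _
  have hmarkov := mul_prob_le_expect (p := execution 1 G K₀ L)
    (s := {K | (uninformed K t).Nonempty}) (c := 1) (slowPotential_nonneg t) fun K hK => by
      have hval : slowPotential t K = 2 ^ (uninformed K t).card := if_pos hK
      rw [hval]
      exact one_le_pow₀ one_le_two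
  rw [one_mul] at hmarkov
  refine hmarkov.trans ((expect_execution_slowPotential_le hG hS L).trans ?_)
  set n := Fintype.card V
  set k := Fintype.card T
  have hpow : (2 : ℝ) ^ (uninformed K₀ t).card ≤ Real.exp (k ^ 2 * Real.log n) := by
    refine le_trans ?_ (Real.exp_le_exp.2 hU)
    rw [← Real.exp_one_pow]
    exact pow_le_pow_left₀ zero_le_two (by linarith [Real.add_one_le_exp 1]) _
  refine (mul_le_mul_of_nonneg_left hpow (Real.exp_nonneg _)).trans ?_
  rw [← Real.exp_add, Real.exp_le_exp]
  have hLr : 2 * (y + 1) * (N : ℝ) ≤ L := by exact_mod_cast hL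
  have h1 : (y + 1) * (k ^ 2 * Real.log n) ≤ L * (1 / (2 * (k : ℝ))) := by
    rw [mul_one_div, le_div_iff₀ (by linarith)]
    calc _ = 2 * (y + 1) * ((k : ℝ) ^ 3 * Real.log n) := by ring
      _ ≤ 2 * (y + 1) * (N : ℝ) := by gcongr
      _ ≤ L := hLr
  have h2 : y * Real.log n ≤ y * (k ^ 2 * Real.log n) := by
    gcongr
    exact le_mul_of_one_le_left hlog (one_le_pow₀ hk)
  linarith

/-- A single token reaches all nodes with high probability. -/
theorem prob_token_le {G : ℕ → SimpleGraph V} (hG : ∀ r, (G r).Connected)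
    {K₀ : Knowledge V T} {t : T} (hS : (informed K₀ t).Nonempty) (y N R : ℕ) (hy : 1 ≤ y)
    (hN : Fintype.card V ≤ N)
    (hN' : (Fintype.card T : ℝ) ^ 3 * Real.log (Fintype.card V) ≤ N)
    (hN5 : N ≤ Fintype.card V ^ 5) (hR : (30 * y + 82) * N ≤ R) :
    prob (execution 1 G K₀ R) {K | (uninformed K t).Nonempty}
      ≤ 6 * Real.exp (-(y * Real.log (Fintype.card V))) := by
  have hk : (1 : ℝ) ≤ Fintype.card T := by exact_mod_cast Fintype.card_pos_iff.2 ⟨t⟩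
  have hn : (0 : ℝ) < Fintype.card V := by exact_mod_cast Fintype.card_pos
  have hlog : 0 ≤ Real.log (Fintype.card V) := Real.log_natCast_nonneg _
  have hNr : (Fintype.card V : ℝ) ≤ N := by exact_mod_cast hN
  have hyr : (1 : ℝ) ≤ y := by exact_mod_cast hy
  have hcard : ∀ K : Knowledge V T,
      ((informed K t).card : ℝ) + (uninformed K t).card = Fintype.card V := fun K => by
    exact_mod_cast card_informed_add_card_uninformed K t
  set δ := Real.exp (-(y * Real.log (Fintype.card V))) with hδ
  have hδ0 : 0 ≤ δ := Real.exp_nonneg _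
  set L := 4 * (2 * y + 9) * N + 4 * (y + 1) * N with hL
  obtain ⟨L', hL', rfl⟩ : ∃ L', 2 * (y + 1) * N ≤ L' ∧ R = 4 * y * N + (L + (L + L')) := by
    have : (30 * y + 82) * N = 4 * y * N + (L + (L + 2 * (y + 1) * N)) := by rw [hL]; ring
    exact ⟨R - (4 * y * N + (L + L)), by omega, by omega⟩
  set n := Fintype.card V with hn_def
  set k := Fintype.card T with hk_def
  have hNk : (k : ℝ) ^ 2 * Real.log n ≤ N := by
    refine le_trans ?_ hN'
    gcongr
    norm_num
  -- Failure budgets of the four stages: slow, down to n/2, down to k² log n, slow.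
  rw [execution_add, show 6 * δ = δ + (2 * δ + (2 * δ + δ)) by ring]
  refine prob_bind_le (by positivity) (prob_execution_few_informed_le hG hS y N hN')
    fun K₁ hK₁ => ?_
  rw [execution_add]
  refine prob_bind_le (s := {K | (n : ℝ) / 2 ≤ (uninformed K t).card}ᶜ) (by positivity) ?_
    fun K₂ hK₂ => ?_
  · rw [compl_compl]
    refine prob_phase_le (fun r => hG _) K₁ t _ y N hN hN' hN5 ?_
    have hgoal : (k : ℝ) ^ 2 * Real.log n * n ≤ 2 * (informed K₁ t).card * N := by
      rcases hK₁ with h | h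
      · rw [mul_comm]
        exact mul_le_mul h hNk (by positivity) (by positivity)
      · have h1 : (N : ℝ) / k ≤ (informed K₁ t).card := by
          refine le_trans ?_ h
          gcongr
          exact le_mul_of_one_le_left (Nat.cast_nonneg N) hyr
        have h2 : (k : ℝ) ^ 2 * Real.log n ≤ N / k := by
          rw [le_div_iff₀ (by linarith)]
          linarith
        calc (k : ℝ) ^ 2 * Real.log n * n ≤ (informed K₁ t).card * N :=
              mul_le_mul (h2.trans h1) hNr hn.le (by positivity)
          _ ≤ _ := by nlinarith [show (0 : ℝ) ≤ (informed K₁ t).card * N by positivity]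
    calc _ = (k : ℝ) ^ 2 * Real.log n * n * n := by ring
      _ ≤ 2 * (informed K₁ t).card * N * n := by gcongr
      _ = _ := by ring
  have hI₂ : (n : ℝ) ≤ 2 * (informed K₂ t).card := by
    have h1 : ((uninformed K₂ t).card : ℝ) < n / 2 := not_le.1 hK₂
    linarith [hcard K₂]
  rw [execution_add]
  have hpos₂ : (informed K₂ t).Nonempty := by
    rw [← Finset.card_pos]
    have : (0 : ℝ) < (informed K₂ t).card := by linarith
    exact_mod_cast this
  -- Monotonicity, which holds almost surely, is kept in the event so that the last stage still has
  -- an informed node.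
  refine prob_bind_le (s := {K | (k : ℝ) ^ 2 * Real.log n ≤ (uninformed K t).card}ᶜ ∩ {K | K₂ ≤ K})
    (by positivity) ?_ fun K₃ hK₃ => ?_
  · refine le_trans ?_ (prob_phase_le (fun r => hG (4 * y * N + (L + r))) K₂ t ((k : ℝ) ^ 2 * Real.log n) y N hN hN' hN5 ?_)
    · refine expect_mono_support fun K hK => ?_
      have hle : K₂ ≤ K := le_of_mem_support_execution hK
      by_cases h : (k : ℝ) ^ 2 * Real.log n ≤ (uninformed K t).card
      · rw [Set.indicator_of_mem (s := {K | (k : ℝ) ^ 2 * Real.log n ≤ (uninformed K t).card})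
          (by exact h)]
        exact Set.indicator_le_self' (by simp) _
      · rw [Set.indicator_of_notMem]
        · exact Set.indicator_nonneg (by simp) _
        · exact fun h' => h' ⟨h, hle⟩
    · calc _ = (k : ℝ) ^ 2 * Real.log n * (n * n) := by ring
        _ ≤ (k : ℝ) ^ 2 * Real.log n * (2 * (informed K₂ t).card * N) := by gcongr
        _ ≤ _ := by
          nlinarith [show 0 ≤ (k : ℝ) ^ 2 * Real.log n * ((informed K₂ t).card * N) by positivity]
  · refine prob_execution_uninformed_le (fun r => hG _)
      (hpos₂.mono (informed_mono hK₃.2 t)) y N L' hN' hL' ?_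
    have h : ¬ (k : ℝ) ^ 2 * Real.log n ≤ (uninformed K₃ t).card := hK₃.1
    exact (not_le.1 h).le

end Assembly

end KBroadcast

end

/-! ### The union bound over tokens -/

theorem mainTheorem2 (x : ℝ) (hx : 1 ≤ x) :
    ∃ C : ℝ, 0 < C ∧
      ∀ (V T : Type*) [Fintype V] [DecidableEq V] [Nontrivial V] [Fintype T] [DecidableEq T]
        (n k : ℕ), Fintype.card V = n → Fintype.card T = k → 1 ≤ k → k ≤ n →
      ∀ (G : ℕ → SimpleGraph V), (∀ r, (G r).Connected) →
      ∀ (K₀ : KBroadcast.Knowledge V T), (∀ t, ∃ v, t ∈ K₀ v) →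
      ∀ R : ℕ, C * ((n : ℝ) + (k : ℝ) ^ 3 * Real.log n) ≤ (R : ℝ) →
        KBroadcast.failureProb 1 G K₀ R ≤ ENNReal.ofReal ((n : ℝ) ^ (-x)) := by
  -- The extra 4 absorbs the union bound: 6k ≤ n^4. The factor 2 in C below pays for rounding n + k³
  -- log n up to an integer.
  set y := ⌈x⌉₊ + 4 with hy
  have hxy : x + 4 ≤ y := by
    rw [hy]
    push_cast
    linarith [Nat.le_ceil x]
  refine ⟨2 * (30 * y + 82), by positivity, ?_⟩
  rintro V T _ _ _ _ _ n k rfl rfl hk hkn G hG K₀ hK₀ R hR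
  rw [KBroadcast.failureProb, KBroadcast.toOuterMeasure_eq_ofReal_prob]
  refine ENNReal.ofReal_le_ofReal ?_
  have hn2 : 2 ≤ Fintype.card V := Fintype.one_lt_card
  have hn2r : (2 : ℝ) ≤ Fintype.card V := by exact_mod_cast hn2
  have hlog : 0 ≤ Real.log (Fintype.card V) := Real.log_natCast_nonneg _
  have hloglt : Real.log (Fintype.card V) ≤ Fintype.card V :=
    Real.log_le_self (Nat.cast_nonneg _)
  have hsub : {K : KBroadcast.Knowledge V T | ¬ KBroadcast.Solved K}
      ⊆ ⋃ t ∈ (Finset.univ : Finset T), {K | (KBroadcast.uninformed K t).Nonempty} := by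
    intro K hK
    simp only [KBroadcast.Solved, Set.mem_ofPred_eq, not_forall] at hK
    obtain ⟨v, t, hvt⟩ := hK
    simp only [Set.mem_iUnion]
    exact ⟨t, Finset.mem_univ t, v, by simpa using hvt⟩
  set a := (Fintype.card V : ℝ) + (Fintype.card T : ℝ) ^ 3 * Real.log (Fintype.card V) with ha
  have hT : (0 : ℝ) ≤ (Fintype.card T : ℝ) ^ 3 * Real.log (Fintype.card V) := by positivity
  have hceil : (⌈a⌉₊ : ℝ) ≤ 2 * a := by
    have := (Nat.ceil_lt_add_one (show 0 ≤ a by positivity)).le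
    linarith
  have hN : Fintype.card V ≤ ⌈a⌉₊ := by
    have : (Fintype.card V : ℝ) ≤ ⌈a⌉₊ := le_trans (by linarith) (Nat.le_ceil a)
    exact_mod_cast this
  have hN5 : ⌈a⌉₊ ≤ Fintype.card V ^ 5 := by
    rw [Nat.ceil_le, Nat.cast_pow]
    have hkr : (Fintype.card T : ℝ) ≤ Fintype.card V := by exact_mod_cast hkn
    have h1 : (Fintype.card T : ℝ) ^ 3 * Real.log (Fintype.card V)
        ≤ (Fintype.card V : ℝ) ^ 3 * Fintype.card V := by gcongr
    have h2 : (Fintype.card V : ℝ) ≤ (Fintype.card V : ℝ) ^ 4 :=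
      le_self_pow₀ (by linarith) (by norm_num)
    have h3 : 2 * (Fintype.card V : ℝ) ^ 4 ≤ Fintype.card V * (Fintype.card V : ℝ) ^ 4 := by gcongr
    rw [ha]
    linarith [show (Fintype.card V : ℝ) ^ 3 * Fintype.card V = (Fintype.card V : ℝ) ^ 4 by ring,
      show Fintype.card V * (Fintype.card V : ℝ) ^ 4 = (Fintype.card V : ℝ) ^ 5 by ring]
  have hRN : (30 * y + 82) * ⌈a⌉₊ ≤ R := by
    have : (30 * y + 82 : ℝ) * ⌈a⌉₊ ≤ R := by
      calc _ ≤ (30 * y + 82 : ℝ) * (2 * a) := by gcongr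
        _ = 2 * (30 * y + 82) * a := by ring
        _ ≤ R := hR
    exact_mod_cast this
  refine (KBroadcast.prob_mono hsub).trans ((KBroadcast.prob_biUnion_le _ _ _).trans ?_)
  refine (Finset.sum_le_card_nsmul _ _ _ fun t _ =>
    KBroadcast.prob_token_le hG (t := t) ?_ y ⌈a⌉₊ R (by omega) hN
      (le_trans (by linarith) (Nat.le_ceil a)) hN5 hRN).trans ?_
  · obtain ⟨v, hv⟩ := hK₀ t
    exact ⟨v, by simpa using hv⟩
  · rw [Finset.card_univ, nsmul_eq_mul, Real.rpow_def_of_pos (by linarith)]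
    have h6 : Fintype.card T * 6 ≤ Fintype.card V ^ 4 := by
      calc Fintype.card T * 6 ≤ Fintype.card V * 2 ^ 3 := Nat.mul_le_mul hkn (by norm_num)
        _ ≤ Fintype.card V * Fintype.card V ^ 3 := by gcongr
        _ = _ := by ring
    have h6r : (Fintype.card T : ℝ) * 6 ≤ Real.exp (4 * Real.log (Fintype.card V)) := by
      rw [show (4 : ℝ) = ((4 : ℕ) : ℝ) by norm_num, Real.exp_nat_mul,
        Real.exp_log (by linarith)]
      exact_mod_cast h6
    rw [← mul_assoc]
    refine (mul_le_mul_of_nonneg_right h6r (Real.exp_nonneg _)).trans ?_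
    rw [← Real.exp_add, Real.exp_le_exp]
    nlinarith [mul_le_mul_of_nonneg_right hxy hlog]
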